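/- Let $p$ be a prime, let $n\ge 1$, let $\zeta=\zeta_{p^n}$ be a primitive $p^n$-th root of unity over $\mathbb{Q}$, let $T=\mathbb{Z}_{(p)}[\zeta]$, a discrete valuation ring with maximal ideal generated by $t=1-\zeta$, and let $v_t$ be the $t$-adic valuation. For $i\in(\mathbb{Z}/p^n)^*$ let $\sigma_i$ be the automorphism of $T$ over $\mathbb{Z}_{(p)}$ with $\sigma_i(\zeta)=\zeta^i$. Consider the cyclotomic Dedekind embedding $$\delta:\; T\otimes_{\mathbb{Z}_{(p)}}T\longrightarrow\prod_{i\in(\mathbb{Z}/p^n)^*}T,\qquad x\otimes y\mapsto (x\,\sigma_i(y))_i,\qquad\text{so that}\quad \zeta^k\otimes\zeta^l\mapsto(\zeta^{k+il})_i,$$ which is $T$-linear for the action of $T$ on the left tensor factor. The $T$-linear elementary divisors of $\delta$ are the diagonal entries $d_1\mid d_2\mid\dots\mid d_m$ of a square diagonal matrix, each entry dividing the next, that describes $\delta$ with respect to suitable $T$-bases of source and target; such a diagonal form exists, and $v_t(d_k)$ does not depend on its choice. Let $j$ be an integer with $0\le j\le p^n-1$ that is not divisible by $p$, write $j=\sum_{s\ge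 0}a_sp^s$ with $0\le a_s\le p-1$, and let $N(j)$ be the number of integers in $[0,j]$ that are not divisible by $p$. Then the $N(j)$-th $T$-linear elementary divisor $d_{N(j)}$ of $\delta$ has valuation $$v_t\bigl(d_{N(j)}\bigr)=-1+\sum_{s\ge 0}\bigl(a_s(s+1)-a_{s+1}(s+2)\bigr)p^s .$$ -/

import Mathlib

open scoped TensorProduct

noncomputable section

namespace CycDedekind

/-- The ring `ℤ_(p)`: the localization of `ℤ` at the prime ideal `(p)`, as a subring of `ℚ`. -/
def ZLoc (p : ℕ) [Fact p.Prime] : Subalgebra ℤ ℚ :=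
  haveI : (Ideal.span {(p : ℤ)}).IsPrime := (Int.ideal_span_isMaximal_of_prime p).isPrime
  Localization.subalgebra.ofField ℚ (Ideal.span {(p : ℤ)}).primeCompl
    (Ideal.primeCompl_le_nonZeroDivisors _)

/-- `ℤ_(p)` consists of the fractions whose denominator is prime to `p`. -/
theorem mem_ZLoc {p : ℕ} [Fact p.Prime] (x : ℚ) :
    x ∈ ZLoc p ↔ ∃ a s : ℤ, ¬ (p : ℤ) ∣ s ∧ x = a / s := by
  have : (Ideal.span {(p : ℤ)}).IsPrime := (Int.ideal_span_isMaximal_of_prime p).isPrime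
  change (∃ (a s : ℤ) (_ : s ∈ (Ideal.span {(p : ℤ)}).primeCompl),
    x = algebraMap ℤ ℚ a * (algebraMap ℤ ℚ s)⁻¹) ↔ _
  simp only [Ideal.mem_primeCompl_iff, Ideal.mem_span_singleton, exists_prop, div_eq_mul_inv,
    algebraMap_int_eq, eq_intCast]

variable {L : Type*} [Field L] [Algebra ℚ L]

/-- The ring `T = ℤ_(p)[ζ]`, as a subring of the field `L` containing `ζ`. -/
def CycRing (p : ℕ) [Fact p.Prime] (ζ : L) : Subalgebra (ZLoc p) L :=
  Algebra.adjoin (ZLoc p) {ζ}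

/-- The element `ζ` of `ℤ_(p)[ζ]`. -/
def zetaElt (p : ℕ) [Fact p.Prime] (ζ : L) : CycRing p ζ :=
  ⟨ζ, Algebra.self_mem_adjoin_singleton _ _⟩

/-- The element `t = 1 - ζ` of `ℤ_(p)[ζ]`. -/
def tElt (p : ℕ) [Fact p.Prime] (ζ : L) : CycRing p ζ := 1 - zetaElt p ζ

variable {p n : ℕ} [Fact p.Prime] [IsCyclotomicExtension {p ^ n} ℚ L]

/-- The automorphism of the field `L = ℚ(ζ_{p^n})` over `ℚ` that belongs to `i ∈ (ℤ/p^n)^*`. -/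
def fieldAut (L : Type*) [Field L] [Algebra ℚ L] (p n : ℕ) [Fact p.Prime]
    [IsCyclotomicExtension {p ^ n} ℚ L] (i : (ZMod (p ^ n))ˣ) : L ≃ₐ[ℚ] L :=
  haveI : NeZero (p ^ n) := ⟨pow_ne_zero n (Fact.out : p.Prime).ne_zero⟩
  (IsCyclotomicExtension.autEquivPow L (n := p ^ n)
    (Polynomial.cyclotomic.irreducible_rat (NeZero.pos _))).symm i

theorem fieldAut_apply {ζ : L} (hζ : IsPrimitiveRoot ζ (p ^ n)) (i : (ZMod (p ^ n))ˣ) :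
    fieldAut L p n i ζ = ζ ^ (i : ZMod (p ^ n)).val := by
  have : NeZero (p ^ n) := ⟨pow_ne_zero n (Fact.out : p.Prime).ne_zero⟩
  obtain ⟨σ, rfl⟩ := (IsCyclotomicExtension.autEquivPow L (n := p ^ n)
    (Polynomial.cyclotomic.irreducible_rat (NeZero.pos _))).surjective i
  obtain ⟨a, -, rfl⟩ :=
    (IsCyclotomicExtension.zeta_spec (p ^ n) ℚ L).eq_pow_of_pow_eq_one hζ.pow_eq_one
  simp only [fieldAut, MulEquiv.symm_apply_apply]
  rw [map_pow, pow_right_comm, IsCyclotomicExtension.autEquivPow_apply, OneHom.toFun_eq_coe,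
    MonoidHom.toOneHom_coe, IsPrimitiveRoot.autToPow_spec]

/-- The restriction to `R[ζ]` of an `R`-algebra endomorphism that maps `ζ` to a power of `ζ`. -/
def restrictAdjoin {R E : Type*} [CommRing R] [CommRing E] [Algebra R E] {ζ : E} (f : E →ₐ[R] E)
    (hf : ∃ k : ℕ, f ζ = ζ ^ k) : Algebra.adjoin R {ζ} →ₐ[R] Algebra.adjoin R {ζ} :=
  (f.comp (Algebra.adjoin R {ζ}).val).codRestrict (Algebra.adjoin R {ζ}) (by
    obtain ⟨k, hk⟩ := hf
    have h : Algebra.adjoin R {ζ} ≤ (Algebra.adjoin R {ζ}).comap f := by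
      refine Algebra.adjoin_le (Set.singleton_subset_iff.2 ?_)
      change f ζ ∈ Algebra.adjoin R {ζ}
      rw [hk]
      exact pow_mem (Algebra.self_mem_adjoin_singleton _ _) _
    exact fun x => h x.2)

/-- The restriction to `ℤ_(p)[ζ]` of the Galois automorphism that belongs to `i ∈ (ℤ/p^n)^*`. -/
def ringAut {ζ : L} (hζ : IsPrimitiveRoot ζ (p ^ n)) (i : (ZMod (p ^ n))ˣ) :
    CycRing p ζ →ₐ[ZLoc p] CycRing p ζ :=
  restrictAdjoin ((fieldAut L p n i).toAlgHom.restrictScalars (ZLoc p))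
    ⟨_, fieldAut_apply hζ i⟩

theorem coe_ringAut {ζ : L} (hζ : IsPrimitiveRoot ζ (p ^ n)) (i : (ZMod (p ^ n))ˣ)
    (x : CycRing p ζ) : (ringAut hζ i x : L) = fieldAut L p n i x := rfl

/-- For `R`-algebra endomorphisms `σ_i` of `T`, the map `T ⊗ T → ∏_i T`,
`x ⊗ y ↦ (x σ_i(y))_i`, linear over `T` acting on the left tensor factor. -/
def twistedMul {R T ι : Type*} [CommRing R] [CommRing T] [Algebra R T] (σ : ι → T →ₐ[R] T) :
    T ⊗[R] T →ₐ[T] (ι → T) :=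
  Algebra.TensorProduct.lift (Algebra.ofId T (ι → T)) (AlgHom.pi σ) (fun _ _ => Commute.all _ _)

theorem twistedMul_tmul {R T ι : Type*} [CommRing R] [CommRing T] [Algebra R T]
    (σ : ι → T →ₐ[R] T) (x y : T) (i : ι) : twistedMul σ (x ⊗ₜ y) i = x * σ i y := by
  simp [twistedMul, Algebra.ofId_apply]

/-- The Dedekind embedding `T ⊗ T → ∏_{i ∈ (ℤ/p^n)^*} T`, `x ⊗ y ↦ (x σ_i(y))_i`,
for `T = ℤ_(p)[ζ]`, the tensor product being taken over `ℤ_(p)`. -/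
def dedekind {ζ : L} (hζ : IsPrimitiveRoot ζ (p ^ n)) :
    CycRing p ζ ⊗[ZLoc p] CycRing p ζ →ₐ[CycRing p ζ] ((ZMod (p ^ n))ˣ → CycRing p ζ) :=
  twistedMul (ringAut hζ)

theorem dedekind_zeta {ζ : L} (hζ : IsPrimitiveRoot ζ (p ^ n)) (k l : ℕ) (i : (ZMod (p ^ n))ˣ) :
    dedekind hζ ((zetaElt p ζ ^ k) ⊗ₜ (zetaElt p ζ ^ l)) i =
      zetaElt p ζ ^ (k + (i : ZMod (p ^ n)).val * l) := by
  have h : ringAut hζ i (zetaElt p ζ) = zetaElt p ζ ^ (i : ZMod (p ^ n)).val :=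
    Subtype.ext (fieldAut_apply hζ i)
  rw [dedekind, twistedMul_tmul, map_pow, h, pow_add, pow_mul]

/-- `d` is the diagonal of an elementary divisor form of the `R`-linear map `f`: in suitable bases
of source and target, `f` is given by the square diagonal matrix with entries `d 0, d 1, …`,
and each of these entries divides all later ones. -/
def IsElementaryDivisorForm {R M N : Type*} [CommRing R] [AddCommMonoid M] [Module R M]
    [AddCommMonoid N] [Module R N] (f : M →ₗ[R] N) {m : ℕ} (d : Fin m → R) : Prop :=
  (∀ i j : Fin m, i ≤ j → d i ∣ d j) ∧
    ∃ (b : Module.Basis (Fin m) R M) (c : Module.Basis (Fin m) R N), ∀ i, f (b i) = d i • c i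

/-- `e` is a `k`-th elementary divisor (counted from `1`) of the `R`-linear map `f`. -/
def IsElementaryDivisor {R M N : Type*} [CommRing R] [AddCommMonoid M] [Module R M]
    [AddCommMonoid N] [Module R N] (f : M →ₗ[R] N) (k : ℕ) (e : R) : Prop :=
  ∃ (m : ℕ) (d : Fin m → R), IsElementaryDivisorForm f d ∧ ∃ i : Fin m, (i : ℕ) + 1 = k ∧ d i = e

/-- The number of elements of `[0, j]` that are not divisible by `p`. -/
def numNonMultiples (p j : ℕ) : ℕ := ((Finset.Icc 0 j).filter (fun i => ¬ p ∣ i)).card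

/-- The coefficient of `p ^ s` in the `p`-adic expansion of `j`. -/
def padicDigit (p j s : ℕ) : ℕ := j / p ^ s % p

/-- The digits lie in `[0, p - 1]`, and `j` is the sum of its digits times the powers of `p`. -/
theorem padicDigit_spec {p n j : ℕ} (hp : 0 < p) (hj : j < p ^ n) :
    (∀ s, padicDigit p j s < p) ∧ (∀ s, n ≤ s → padicDigit p j s = 0) ∧
      j = ∑ s ∈ Finset.range n, padicDigit p j s * p ^ s := by
  refine ⟨fun s => Nat.mod_lt _ hp, fun s hs => ?_, ?_⟩
  · have : j < p ^ s := hj.trans_le (Nat.pow_le_pow_right hp hs)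
    simp [padicDigit, Nat.div_eq_of_lt this]
  · have key : ∀ m, j % p ^ m = ∑ s ∈ Finset.range m, padicDigit p j s * p ^ s := by
      intro m
      induction m with
      | zero => simp [Nat.mod_one]
      | succ m ih => rw [Finset.sum_range_succ, ← ih, Nat.mod_pow_succ, padicDigit, mul_comm (p ^ m)]
    rw [← key, Nat.mod_eq_of_lt hj]

end CycDedekind

end

/-!
For a polynomial `f` over `T = ℤ_(p)[ζ]`, the `i`-th component of the Dedekind embedding sends
`f(1 ⊗ ζ)` to `f(ζ ^ i)`. As `T ⊗ T` is spanned over `T` by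
the powers of `1 ⊗ ζ` of exponent below `m = φ(p ^ n)`, the embedding is the evaluation of
polynomials of degree below `m` at the `m` points `ζ ^ i`, `p ∤ i`.

Order the points as `x_0, x_1, …` by increasing exponent `i`. The Newton polynomials
`∏_{l < k} (X - x_l)` are evaluated by a lower triangular matrix with diagonal entries
`d_k = ∏_{l < k} (x_k - x_l)`. If `d_k` divides the whole `k`-th column, then dividing each column
by its diagonal entry leaves a unitriangular matrix, so that the `d_k` are the elementary divisors
(`isElementaryDivisorForm_newton`).

The element `t = 1 - ζ` is prime (`prime_tElt`), and `ζ ^ i - ζ ^ l` is associated to `t ^ (p ^ v)`,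
where `v` is the `p`-adic valuation of `i - l` (`associated_pow_sub_pow`). Writing
`p ^ v = 1 + ∑_{1 ≤ s ≤ v} (p ^ s - p ^ (s - 1))` reduces the sums of these exponents to counting
residue classes in `[0, j)`. The class of `j` modulo `p ^ s` has `⌊j / p ^ s⌋` elements there, and
every other class prime to `p` at least as many, which gives the required divisibility
(`sum_gapExponent_le`). The same count gives the valuation of the divisor that belongs to `j`,
`j - ⌊j / p⌋ - 1 + ∑_{s ≥ 1} (p ^ s - p ^ (s - 1)) ⌊j / p ^ s⌋`, and summation by parts turns this
into the digit formula (`sum_gapExponent_self`). That the valuation is the same for every diagonal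
form is `IsElementaryDivisorForm.emultiplicity_eq`.
-/

namespace CycDedekind

/-! ### Uniqueness of elementary divisors at a prime -/

/-- If a prime power `t ^ w` divided `d' k` but not `d k`, then in the matrix of base change from
`b` to `b'` the block with rows `≤ k` and columns `≥ k` would vanish modulo `t`; this block is too
large for the determinant to be a unit. -/
theorem IsElementaryDivisorForm.pow_dvd {R M N : Type*} [CommRing R] [IsDomain R]
    [AddCommGroup M] [Module R M] [AddCommGroup N] [Module R N] {f : M →ₗ[R] N} {m : ℕ}
    {d d' : Fin m → R} (h : IsElementaryDivisorForm f d) (h' : IsElementaryDivisorForm f d')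
    {t : R} (ht : Prime t) {k : Fin m} {w : ℕ} (hw : t ^ w ∣ d' k) : t ^ w ∣ d k := by
  obtain ⟨hd, b, c, hbc⟩ := h
  obtain ⟨hd', b', c', hbc'⟩ := h'
  by_contra hk
  have hrepr : ∀ x l, c.repr (f x) l = d l * b.repr x l := by
    intro x l
    have : c.coord l ∘ₗ f = d l • b.coord l := b.ext fun i => by
      rcases eq_or_ne i l with rfl | hil
      · simp [hbc]
      · simp [hbc, hil]
    exact DFunLike.congr_fun this x
  have hblock : ∀ i l, k ≤ i → l ≤ k → t ∣ b.toMatrix b' l i := by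
    intro i l hi hl
    by_contra hnot
    refine hk (dvd_trans ?_ (hd l k hl))
    refine ht.pow_dvd_of_dvd_mul_left w hnot ?_
    rw [Module.Basis.toMatrix_apply, mul_comm, ← hrepr, hbc', map_smul]
    exact (hw.trans (hd' k i hi)).mul_right _
  refine ht.not_isUnit (isUnit_of_dvd_unit ?_ (b.isUnit_det b'))
  rw [Module.Basis.det_apply, Matrix.det_apply]
  refine Finset.dvd_sum fun σ _ => ?_
  -- `σ` cannot inject the indices `≥ k` into the indices `> k`.
  obtain ⟨i, hi, hσ⟩ : ∃ i, k ≤ i ∧ σ i ≤ k := by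
    by_contra! hcon
    have := Finset.card_le_card_of_injOn (s := Finset.Ici k) (t := Finset.Ioi k) σ
      (fun i hi => by simpa using hcon i (by simpa using hi)) σ.injective.injOn
    simp only [Fin.card_Ici, Fin.card_Ioi] at this
    have := k.2
    omega
  exact dvd_smul_of_dvd _ ((hblock i _ hi hσ).trans
    (Finset.dvd_prod_of_mem (fun i => b.toMatrix b' (σ i) i) (Finset.mem_univ i)))

/-- The `t`-adic valuation of the `k`-th elementary divisor does not depend on the choice of the
diagonal form. -/
theorem IsElementaryDivisorForm.emultiplicity_eq {R M N : Type*} [CommRing R] [IsDomain R]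
    [AddCommGroup M] [Module R M] [AddCommGroup N] [Module R N] {f : M →ₗ[R] N} {m : ℕ}
    {d : Fin m → R} (h : IsElementaryDivisorForm f d) {t : R} (ht : Prime t) (k : Fin m) {e : R}
    (he : IsElementaryDivisor f (k + 1) e) : emultiplicity t e = emultiplicity t (d k) := by
  obtain ⟨m', d', h', i, hi, rfl⟩ := he
  obtain rfl : m' = m := by
    obtain ⟨-, b, -⟩ := h
    obtain ⟨-, b', -⟩ := h'
    simpa using Fintype.card_congr (b'.indexEquiv b)
  obtain rfl : i = k := Fin.ext (by omega)
  exact emultiplicity_eq_emultiplicity_iff.2 fun w => ⟨h.pow_dvd h' ht, h'.pow_dvd h ht⟩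

/-! ### The Newton basis -/

/-- The Newton polynomial `∏_{l < k} (X - x_l)` at the element `y` of an algebra. -/
def newton {R A : Type*} [CommRing R] [CommRing A] [Algebra R A] (x : ℕ → R) (k : ℕ) (y : A) : A :=
  ∏ l ∈ Finset.range k, (y - algebraMap R A (x l))

theorem newton_succ {R A : Type*} [CommRing R] [CommRing A] [Algebra R A] (x : ℕ → R) (k : ℕ)
    (y : A) : newton x (k + 1) y = newton x k y * (y - algebraMap R A (x k)) :=
  Finset.prod_range_succ _ _

theorem newton_self {R : Type*} [CommRing R] (x : ℕ → R) (k : ℕ) (y : R) :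
    newton x k y = ∏ l ∈ Finset.range k, (y - x l) := rfl

theorem newton_eq_zero {R : Type*} [CommRing R] (x : ℕ → R) {i k : ℕ} (hik : i < k) :
    newton x k (x i) = 0 :=
  Finset.prod_eq_zero (Finset.mem_range.2 hik) (sub_self _)

/-- Newton polynomials of degree below `m` span the powers of exponent below `m`. -/
theorem pow_mem_span_newton {R A : Type*} [CommRing R] [CommRing A] [Algebra R A] (x : ℕ → R)
    (y : A) {m l : ℕ} (hl : l < m) :
    y ^ l ∈ Submodule.span R (Set.range fun k : Fin m => newton x k y) := by
  suffices H : ∀ l, y ^ l ∈ Submodule.span R ((fun k => newton x k y) '' Set.Iic l) by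
    refine Submodule.span_mono ?_ (H l)
    rintro _ ⟨k, hk, rfl⟩
    exact ⟨⟨k, lt_of_le_of_lt hk hl⟩, rfl⟩
  clear hl l
  intro l
  induction l with
  | zero => exact Submodule.subset_span ⟨0, by simp, by simp [newton]⟩
  | succ l ih =>
    rw [pow_succ, mul_comm]
    refine Submodule.span_induction
      (p := fun z _ => y * z ∈ Submodule.span R ((fun k => newton x k y) '' Set.Iic (l + 1)))
      ?_ (by simp) (fun a b _ _ ha hb => by rw [mul_add]; exact add_mem ha hb)
      (fun r a _ ha => by rw [mul_smul_comm]; exact Submodule.smul_mem _ _ ha) ih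
    rintro _ ⟨k, hk, rfl⟩
    have hk' : k ≤ l := hk
    have : y * newton x k y = newton x (k + 1) y + x k • newton x k y := by
      rw [newton_succ, Algebra.smul_def]; ring
    simp only [this]
    exact add_mem (Submodule.subset_span ⟨k + 1, by simpa using hk', rfl⟩)
      (Submodule.smul_mem _ _ (Submodule.subset_span ⟨k, by simp; omega, rfl⟩))

/-- Let `f` be an algebra map to `R ^ ι` that evaluates polynomials of degree below `m` in `y`
at `m` points `x_0, x_1, …`. If the points are ordered such that the `k`-th Newton polynomial
takes at `x_k` a value that divides all its other values, then the Newton polynomials are mapped to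
multiples of a unitriangular basis, and the elementary divisors are `∏_{l < k} (x_k - x_l)`. -/
theorem isElementaryDivisorForm_newton {R A ι : Type*} [CommRing R] [IsDomain R] [CommRing A]
    [Algebra R A] (f : A →ₐ[R] (ι → R)) (y : A) {m : ℕ} (e : Fin m ≃ ι) (x : ℕ → R)
    (hspan : ⊤ ≤ Submodule.span R (Set.range fun l : Fin m => y ^ (l : ℕ)))
    (hf : ∀ k : Fin m, f y (e k) = x k)
    (hne : ∀ k < m, newton x k (x k) ≠ 0)
    (hdvd : ∀ k < m, ∀ i < m, newton x k (x k) ∣ newton x k (x i)) :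
    IsElementaryDivisorForm f.toLinearMap (fun k : Fin m => newton x k (x k)) := by
  classical
  have : Fintype ι := Fintype.ofEquiv _ e
  choose q hq using hdvd
  have hfn : ∀ k i : Fin m, f (newton x k y) (e i) = newton x k (x i) := by
    intro k i
    simp [newton, map_prod, Finset.prod_apply, hf]
  -- The columns of the evaluation matrix, divided by their diagonal entries.
  let Q : Matrix (Fin m) (Fin m) R := fun i k => q k k.2 i i.2
  have hQ1 : ∀ k, Q k k = 1 := by
    intro k
    have h := hq k k.2 k k.2
    exact mul_left_cancel₀ (hne k k.2) (by rw [mul_one]; exact h.symm)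
  have hQ0 : ∀ i k : Fin m, i < k → Q i k = 0 := by
    intro i k hik
    have h := hq k k.2 i i.2
    rw [newton_eq_zero x hik] at h
    exact (mul_eq_zero.1 h.symm).resolve_left (hne k k.2)
  have hQ : IsUnit Q.det := by
    rw [Matrix.det_of_isLowerTriangular]
    · simp [hQ1]
    · intro i k hik
      exact hQ0 i k (by simpa using hik)
  let std : Module.Basis (Fin m) R (ι → R) := (Pi.basisFun R ι).reindex e.symm
  have hstd : ∀ v : ι → R, ∀ i, std.repr v i = v (e i) := by
    intro v i
    simp [std]
  let v : Fin m → ι → R := fun k j => Q (e.symm j) k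
  have hv : std.toMatrix v = Q := by
    ext i k
    simp [Module.Basis.toMatrix_apply, hstd, v]
  have hvb := (std.is_basis_iff_det (v := v)).2 (by rwa [Module.Basis.det_apply, hv])
  let c := Module.Basis.mk hvb.1 hvb.2.ge
  have hfc : ∀ k : Fin m, f.toLinearMap (newton x k y) = newton x k (x k) • c k := by
    intro k
    ext j
    obtain ⟨i, rfl⟩ := e.surjective j
    simp only [AlgHom.toLinearMap_apply, hfn, c, Module.Basis.mk_apply, Pi.smul_apply, v,
      Equiv.symm_apply_apply, smul_eq_mul]
    exact hq k k.2 i i.2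
  -- Independence of the Newton polynomials comes from their images, nonzero multiples of a basis.
  have hli : LinearIndependent R fun k : Fin m => newton x k y := by
    refine LinearIndependent.of_comp f.toLinearMap ?_
    rw [Fintype.linearIndependent_iff]
    intro g hg k
    have hg' : ∑ k, (g k * newton x k (x k)) • c k = 0 := by
      rw [← hg]
      exact Finset.sum_congr rfl fun k _ => by rw [Function.comp_apply, hfc, mul_smul]
    have h0 := Fintype.linearIndependent_iff.1 c.linearIndependent _ hg' k
    exact (mul_eq_zero.1 h0).resolve_right (hne k k.2)
  refine ⟨fun i k hik => ?_, Module.Basis.mk hli (hspan.trans (Submodule.span_le.2 ?_)), c, ?_⟩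
  · exact (Dvd.intro _ (hq i i.2 k k.2).symm).trans
      (Finset.prod_dvd_prod_of_subset _ _ _ (Finset.range_mono hik))
  · rintro _ ⟨l, rfl⟩
    exact pow_mem_span_newton x y l.2
  · intro k
    rw [Module.Basis.mk_apply]
    exact hfc k

/-! ### Differences of roots of unity -/

section

variable {A : Type*} [CommRing A] [IsDomain A] {p : ℕ} [hp : Fact p.Prime]

theorem associated_one_sub_pow_of_not_dvd {N u : ℕ} {ζ : A} (hζ : IsPrimitiveRoot ζ (p ^ N))
    (hu : ¬ p ∣ u) : Associated (1 - ζ ^ u) (1 - ζ) := by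
  have h := hζ.associated_sub_one_pow_sub_one_of_coprime
    (((hp.out.coprime_iff_not_dvd.2 hu).symm).pow_right N)
  simpa using h.symm.neg_left.neg_right

/-- `1 - ζ ^ p` is the product of the `p` factors `1 - μ ζ`, where `μ ^ p = 1`, and the `μ ζ` are
the prime-to-`p` powers `ζ ^ (1 + c p ^ (N + 1))`. -/
theorem associated_one_sub_pow_prime {N : ℕ} {ζ : A} (hζ : IsPrimitiveRoot ζ (p ^ (N + 2))) :
    Associated (1 - ζ ^ p) ((1 - ζ) ^ p) := by
  have hη : IsPrimitiveRoot (ζ ^ p ^ (N + 1)) p := hζ.pow (pow_pos hp.out.pos _) (by ring)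
  have h := hη.pow_sub_pow_eq_prod_sub_mul 1 ζ hp.out.pos
  rw [one_pow] at h
  have hconst : (1 - ζ) ^ p = ∏ _μ ∈ Polynomial.nthRootsFinset p (1 : A), (1 - ζ) := by
    rw [Finset.prod_const, hη.card_nthRootsFinset]
  rw [h, hconst]
  refine Associated.prod (Polynomial.nthRootsFinset p (1 : A)) (fun μ => 1 - μ * ζ)
    (fun _ => 1 - ζ) fun μ hμ => ?_
  rw [Polynomial.mem_nthRootsFinset hp.out.pos] at hμ
  obtain ⟨c, -, rfl⟩ := hη.eq_pow_of_pow_eq_one hμ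
  rw [← pow_mul, ← pow_succ]
  refine associated_one_sub_pow_of_not_dvd hζ ?_
  rw [pow_succ', mul_assoc, Nat.dvd_add_right (dvd_mul_right _ _)]
  exact hp.out.one_lt.ne' ∘ Nat.dvd_one.1

theorem associated_one_sub_pow_prime_pow {v r : ℕ} {ζ : A}
    (hζ : IsPrimitiveRoot ζ (p ^ (v + r + 1))) :
    Associated (1 - ζ ^ p ^ v) ((1 - ζ) ^ p ^ v) := by
  induction v generalizing ζ with
  | zero => simp
  | succ v ih =>
    have hζp : IsPrimitiveRoot (ζ ^ p) (p ^ (v + r + 1)) :=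
      hζ.pow (pow_pos hp.out.pos _) (by ring)
    have hζ2 : IsPrimitiveRoot ζ (p ^ ((v + r) + 2)) := by convert hζ using 2; ring
    have h1 := ih hζp
    have h2 := (associated_one_sub_pow_prime hζ2).pow_pow (n := p ^ v)
    rw [pow_succ', pow_mul, pow_mul]
    exact h1.trans h2

/-- For distinct `i, l < p ^ (N + 1)` this is `p ^ v`, where `v` is the `p`-adic valuation of
`i - l`, written as a sum over the powers of `p` that divide `i - l`. -/
def gapExponent (p N i l : ℕ) : ℕ :=
  1 + ∑ s ∈ Finset.range N, if l ≡ i [MOD p ^ (s + 1)] then p ^ (s + 1) - p ^ s else 0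

theorem gapExponent_comm (p N i l : ℕ) : gapExponent p N i l = gapExponent p N l i := by
  simp only [gapExponent, Nat.ModEq.comm]

theorem gapExponent_eq_pow {N v u i l : ℕ} (hv : v ≤ N) (hu : ¬ p ∣ u) (h : i = l + p ^ v * u) :
    gapExponent p N i l = p ^ v := by
  have hmod : ∀ s, l ≡ i [MOD p ^ (s + 1)] ↔ s < v := by
    intro s
    have hi : i - l = p ^ v * u := by omega
    rw [Nat.modEq_iff_dvd' (by omega), hi]
    constructor
    · intro hd
      by_contra! hs
      have : p ^ v * p ∣ p ^ v * u := by
        rw [← pow_succ]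
        exact (pow_dvd_pow p (by omega)).trans hd
      exact hu (Nat.dvd_of_mul_dvd_mul_left (pow_pos hp.out.pos v) this)
    · intro hs
      exact (pow_dvd_pow p hs).mul_right u
  obtain ⟨r, rfl⟩ := Nat.exists_eq_add_of_le hv
  simp only [gapExponent, hmod]
  rw [Finset.sum_range_add, Finset.sum_congr rfl
      fun s hs => if_pos (Finset.mem_range.1 hs),
    Finset.sum_range_tsub (pow_right_mono₀ hp.out.one_le)]
  have := Nat.one_le_pow v p hp.out.pos
  simp
  omega

theorem associated_pow_sub_pow {N : ℕ} {ζ : A} (hζ : IsPrimitiveRoot ζ (p ^ (N + 1))) {i l : ℕ}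
    (hi : i < p ^ (N + 1)) (hl : l < p ^ (N + 1)) (hil : i ≠ l) :
    Associated (ζ ^ i - ζ ^ l) ((1 - ζ) ^ gapExponent p N i l) := by
  wlog hlt : l < i generalizing i l
  · rw [gapExponent_comm, ← neg_sub]
    exact (this hl hi hil.symm (by omega)).neg_left
  obtain ⟨v, u, hu, huv⟩ := Nat.exists_eq_pow_mul_and_not_dvd (n := i - l) (by omega) p
    hp.out.ne_one
  have hv : v < N + 1 := by
    rw [← Nat.pow_lt_pow_iff_right hp.out.one_lt]
    have : u ≠ 0 := by rintro rfl; simp at hu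
    have := Nat.le_mul_of_pos_right (p ^ v) (Nat.pos_of_ne_zero this)
    omega
  rw [gapExponent_eq_pow (v := v) (u := u) (by omega) hu (by omega)]
  obtain ⟨r, rfl⟩ : ∃ r, N = v + r := ⟨N - v, by omega⟩
  have hζv : IsPrimitiveRoot (ζ ^ p ^ v) (p ^ (r + 1)) :=
    hζ.pow (pow_pos hp.out.pos _) (by ring)
  have h : ζ ^ i - ζ ^ l = ζ ^ l * -(1 - (ζ ^ p ^ v) ^ u) := by
    rw [← pow_mul, ← huv, neg_sub, mul_sub, ← pow_add, mul_one, Nat.add_sub_cancel' hlt.le]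
  rw [h]
  refine (associated_unit_mul_left _ _ ((hζ.isUnit (pow_ne_zero _ hp.out.ne_zero)).pow l)).trans ?_
  exact ((associated_one_sub_pow_of_not_dvd hζv hu).trans
    (associated_one_sub_pow_prime_pow hζ)).neg_left

end

/-! ### The ring `ℤ_(p)[ζ]` -/

section

variable {L : Type*} [Field L] [Algebra ℚ L] {p : ℕ} [hp : Fact p.Prime] {ζ : L}

theorem isPrimitiveRoot_zetaElt {k : ℕ} (hζ : IsPrimitiveRoot ζ k) :
    IsPrimitiveRoot (zetaElt p ζ) k :=
  IsPrimitiveRoot.of_map_of_injective (f := (CycRing p ζ).val) hζ Subtype.val_injective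

theorem isIntegral_cycRing {k : ℕ} (hk : 0 < k) (hζ : IsPrimitiveRoot ζ k) :
    Algebra.IsIntegral (ZLoc p) (CycRing p ζ) :=
  Algebra.IsIntegral.adjoin (by simpa using (hζ.isIntegral hk).tower_top)

theorem isUnit_or_dvd_zLoc (a : ZLoc p) : IsUnit a ∨ (p : ZLoc p) ∣ a := by
  obtain ⟨x, s, hs, hx⟩ := (mem_ZLoc (a : ℚ)).1 a.2
  have hs0 : (s : ℚ) ≠ 0 := by rintro h; exact hs (by simp [Int.cast_eq_zero.1 h])
  by_cases hpx : (p : ℤ) ∣ x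
  · obtain ⟨y, rfl⟩ := hpx
    refine Or.inr ⟨⟨y / s, (mem_ZLoc _).2 ⟨y, s, hs, rfl⟩⟩, Subtype.ext ?_⟩
    simp [hx, mul_div_assoc]
  · have hx0 : (x : ℚ) ≠ 0 := by rintro h; exact hpx (by simp [Int.cast_eq_zero.1 h])
    refine Or.inl (IsUnit.of_mul_eq_one ⟨s / x, (mem_ZLoc _).2 ⟨s, x, hpx, rfl⟩⟩ (Subtype.ext ?_))
    simp only [MulMemClass.coe_mul, hx, OneMemClass.coe_one]
    field_simp

theorem not_isUnit_prime_zLoc : ¬ IsUnit (p : ZLoc p) := by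
  intro h
  obtain ⟨b, hb⟩ := h.exists_right_inv
  obtain ⟨x, s, hs, hx⟩ := (mem_ZLoc (b : ℚ)).1 b.2
  have hs0 : (s : ℚ) ≠ 0 := by rintro h; exact hs (by simp [Int.cast_eq_zero.1 h])
  have h1 : (p : ℚ) * (x / s) = 1 := by
    rw [← hx]
    simpa using congrArg (Subtype.val) hb
  have h2 : (p : ℚ) * x = s := by field_simp at h1; linarith
  exact hs ⟨x, by exact_mod_cast h2.symm⟩

/-- Modulo `1 - ζ` every element of `ℤ_(p)[ζ]` is congruent to an element of `ℤ_(p)`. -/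
theorem exists_tElt_dvd_sub_algebraMap (x : CycRing p ζ) :
    ∃ a : ZLoc p, tElt p ζ ∣ x - algebraMap (ZLoc p) (CycRing p ζ) a := by
  obtain ⟨x, hx⟩ := x
  induction hx using Algebra.adjoin_induction with
  | mem y hy =>
    obtain rfl : y = ζ := hy
    exact ⟨1, -1, by rw [map_one, tElt]; change zetaElt p y - 1 = _; ring⟩
  | algebraMap r => exact ⟨r, 0, by rw [mul_zero, sub_eq_zero]; rfl⟩
  | add y z hy hz ihy ihz =>
    obtain ⟨a, ha⟩ := ihy
    obtain ⟨b, hb⟩ := ihz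
    refine ⟨a + b, ?_⟩
    convert dvd_add ha hb using 1
    rw [map_add]
    change (⟨y, hy⟩ + ⟨z, hz⟩ : CycRing p ζ) - _ = _
    ring
  | mul y z hy hz ihy ihz =>
    obtain ⟨a, ha⟩ := ihy
    obtain ⟨b, hb⟩ := ihz
    refine ⟨a * b, ?_⟩
    convert dvd_add (ha.mul_right ⟨z, hz⟩) (hb.mul_left (algebraMap _ _ a)) using 1
    rw [map_mul]
    change (⟨y, hy⟩ * ⟨z, hz⟩ : CycRing p ζ) - _ = _
    ring

/-- With `η = ζ ^ (p ^ N)` of order `p`, the element `1 - ζ` divides `1 - η`, which divides `p`;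
conversely `p` is the product of the `1 - η ^ c`, `0 < c < p`, each of them associated to a power
of `1 - ζ`. So the residue ring at `1 - ζ` is a nonzero quotient of the field `ℤ_(p) / p`. -/
theorem prime_tElt {N : ℕ} (hζ : IsPrimitiveRoot ζ (p ^ (N + 1))) : Prime (tElt p ζ) := by
  have hz := isPrimitiveRoot_zetaElt (p := p) hζ
  have hint := isIntegral_cycRing (p := p) (pow_pos hp.out.pos _) hζ
  have hη : IsPrimitiveRoot (zetaElt p ζ ^ p ^ N) p := hz.pow (pow_pos hp.out.pos _) (by ring)
  have hzne : zetaElt p ζ ≠ 1 := hz.ne_one (Nat.one_lt_pow (by omega) hp.out.one_lt)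
  have hdvd : tElt p ζ ∣ (p : CycRing p ζ) := by
    have h1 := sub_one_dvd_natCast_of_pow_eq_one hη.pow_eq_one (hη.ne_one hp.out.one_lt)
    have h2 := sub_dvd_pow_sub_pow (zetaElt p ζ) 1 (p ^ N)
    rw [one_pow] at h2
    have h3 : tElt p ζ = -(zetaElt p ζ - 1) := by rw [tElt]; ring
    rw [h3]
    exact neg_dvd.2 (h2.trans h1)
  have hunit : ¬ IsUnit (tElt p ζ) := by
    intro h
    have hpu : IsUnit (p : CycRing p ζ) := by
      obtain ⟨q, hq⟩ : ∃ q, p = q + 1 := ⟨p - 1, by have := hp.out.pos; omega⟩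
      have hηq : IsPrimitiveRoot (zetaElt p ζ ^ p ^ N) (q + 1) := hq ▸ hη
      have hprod := hηq.prod_one_sub_pow_eq_order
      have hpq : (p : CycRing p ζ) = q + 1 := by
        exact_mod_cast congrArg (Nat.cast (R := CycRing p ζ)) hq
      rw [hpq, ← hprod]
      refine (IsUnit.prod_iff).2 fun c hc => ?_
      have hc' : ¬ p ∣ c + 1 := Nat.not_dvd_of_pos_of_lt (by omega)
        (by have := Finset.mem_range.1 hc; omega)
      have h1 := associated_one_sub_pow_of_not_dvd (p := p) (N := 1) (by simpa using hη) hc'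
      have h2 := associated_one_sub_pow_prime_pow (v := N) (r := 0) hz
      exact (h1.trans h2).symm.isUnit (h.pow _)
    have : IsUnit (algebraMap (ZLoc p) (CycRing p ζ) p) := by simpa using hpu
    have hinj : FaithfulSMul (ZLoc p) (CycRing p ζ) :=
      (faithfulSMul_iff_algebraMap_injective _ _).2 fun a b hab =>
        Subtype.ext ((algebraMap ℚ L).injective (congrArg Subtype.val hab))
    exact not_isUnit_prime_zLoc (isUnit_of_map_unit (algebraMap (ZLoc p) (CycRing p ζ)) _ this)
  -- Elements outside the ideal `(t)` are units modulo `t`.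
  have hres : ∀ x : CycRing p ζ, ¬ tElt p ζ ∣ x → ∃ u, IsUnit u ∧ tElt p ζ ∣ x - u := by
    intro x hx
    obtain ⟨a, ha⟩ := exists_tElt_dvd_sub_algebraMap x
    rcases isUnit_or_dvd_zLoc a with hu | hd
    · exact ⟨_, hu.map _, ha⟩
    · refine absurd ?_ hx
      have : tElt p ζ ∣ algebraMap (ZLoc p) (CycRing p ζ) a :=
        hdvd.trans (by simpa using map_dvd (algebraMap (ZLoc p) (CycRing p ζ)) hd)
      simpa using dvd_add ha this
  refine ⟨sub_ne_zero.2 hzne.symm, hunit, fun x y hxy => ?_⟩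
  by_contra! hcon
  obtain ⟨u, hu, hxu⟩ := hres x hcon.1
  obtain ⟨w, hw, hyw⟩ := hres y hcon.2
  refine hunit (isUnit_of_dvd_unit ?_ (hu.mul hw))
  have h : u * w = x * y - ((x - u) * y + u * (y - w)) := by ring
  rw [h]
  exact dvd_sub hxy (dvd_add (hxu.mul_right y) (hyw.mul_left u))

end

/-! ### Sums of gap exponents -/

theorem sum_gapExponent {p : ℕ} (N : ℕ) {k i : ℕ} (hi : ¬ p ∣ i) :
    ∑ l ∈ Finset.range k with ¬ p ∣ l, gapExponent p N i l =
      k.count (fun l => ¬ p ∣ l) +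
        ∑ s ∈ Finset.range N, k.count (· ≡ i [MOD p ^ (s + 1)]) * (p ^ (s + 1) - p ^ s) := by
  simp only [gapExponent, Finset.sum_add_distrib, Finset.sum_const, smul_eq_mul, mul_one]
  rw [Finset.sum_comm, Nat.count_eq_card_filter_range]
  refine congrArg _ (Finset.sum_congr rfl fun s _ => ?_)
  rw [← Finset.sum_filter, Finset.sum_const, smul_eq_mul, Finset.filter_filter,
    Nat.count_eq_card_filter_range]
  congr 2
  refine Finset.filter_congr fun l _ => and_iff_right_of_imp fun h hl => hi ?_
  exact ((h.of_dvd (dvd_pow_self p s.succ_ne_zero)).dvd_iff dvd_rfl).1 hl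

theorem count_modEq_self (k : ℕ) {r : ℕ} (hr : 0 < r) : k.count (· ≡ k [MOD r]) = k / r := by
  simp [Nat.count_modEq_card _ hr]

section

variable {p : ℕ} [hp : Fact p.Prime]

/-- In the natural order the prime-to-`p` integers are `p`-ordered: in `[0, k)` the residue class
of `k` modulo each power of `p` has no more elements than any other class. -/
theorem sum_gapExponent_le (N : ℕ) {k i : ℕ} (hk : ¬ p ∣ k) (hi : ¬ p ∣ i) :
    ∑ l ∈ Finset.range k with ¬ p ∣ l, gapExponent p N k l ≤
      ∑ l ∈ Finset.range k with ¬ p ∣ l, gapExponent p N i l := by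
  rw [sum_gapExponent N hk, sum_gapExponent N hi]
  refine Nat.add_le_add_left (Finset.sum_le_sum fun s _ => Nat.mul_le_mul_right _ ?_) _
  have hr : 0 < p ^ (s + 1) := pow_pos hp.out.pos _
  rw [count_modEq_self k hr, Nat.count_modEq_card _ hr]
  exact Nat.le_add_right _ _

theorem count_not_dvd {k : ℕ} (hk : ¬ p ∣ k) :
    k.count (fun l => ¬ p ∣ l) + (k / p + 1) = k := by
  have h1 : k.count (fun l => p ∣ l) = k / p + 1 := by
    have h := Nat.count_modEq_card (b := k) hp.out.pos 0
    have hmod : 0 < k % p := Nat.pos_of_ne_zero fun h => hk (Nat.dvd_of_mod_eq_zero h)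
    simpa [Nat.modEq_zero_iff_dvd, hmod] using h
  rw [← h1, Nat.count_eq_card_filter_range, Nat.count_eq_card_filter_range, add_comm,
    Finset.card_filter_add_card_filter_not, Finset.card_range]

/-- Summation by parts, with `a_s = ⌊j / p ^ s⌋ - p ⌊j / p ^ (s + 1)⌋`. -/
theorem sum_padicDigit (p j N : ℕ) :
    ∑ s ∈ Finset.range (N + 1), ((padicDigit p j s : ℤ) * (s + 1) -
        (padicDigit p j (s + 1) : ℤ) * (s + 2)) * (p : ℤ) ^ s =
      j - (j / p : ℕ) +
        ∑ s ∈ Finset.range N, (j / p ^ (s + 1) : ℕ) * ((p : ℤ) ^ (s + 1) - (p : ℤ) ^ s)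
        - (j / p ^ (N + 1) : ℕ) * ((p : ℤ) ^ N + (N + 1) * (p : ℤ) ^ (N + 1))
        + (N + 2) * (j / p ^ (N + 2) : ℕ) * (p : ℤ) ^ (N + 1) := by
  have hdigit : ∀ s, (padicDigit p j s : ℤ) = (j / p ^ s : ℕ) - p * (j / p ^ (s + 1) : ℕ) := by
    intro s
    rw [padicDigit, pow_succ, ← Nat.div_div_eq_div_mul, eq_sub_iff_add_eq]
    exact_mod_cast Nat.mod_add_div _ _
  induction N with
  | zero =>
    rw [Finset.sum_range_one, hdigit, hdigit, Finset.range_zero, Finset.sum_empty]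
    simp only [pow_zero, Nat.div_one, zero_add, pow_one]
    ring
  | succ N ih =>
    rw [Finset.sum_range_succ, ih, Finset.sum_range_succ, hdigit, hdigit]
    generalize ((j / p ^ (N + 1) : ℕ) : ℤ) = a
    push_cast
    ring

theorem sum_gapExponent_self {N j : ℕ} (hj : j < p ^ (N + 1)) (hpj : ¬ p ∣ j) :
    ((∑ l ∈ Finset.range j with ¬ p ∣ l, gapExponent p N j l : ℕ) : ℤ) =
      -1 + ∑ s ∈ Finset.range (N + 1), ((padicDigit p j s : ℤ) * (s + 1) -
        (padicDigit p j (s + 1) : ℤ) * (s + 2)) * (p : ℤ) ^ s := by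
  have h0 : j / p ^ (N + 1) = 0 := Nat.div_eq_of_lt hj
  have h1 : j / p ^ (N + 2) = 0 :=
    Nat.div_eq_of_lt (hj.trans_le (Nat.pow_le_pow_right hp.out.pos (by omega)))
  have hcount : (j.count (fun l => ¬ p ∣ l) : ℤ) = j - (j / p : ℕ) - 1 := by
    have := count_not_dvd hpj
    omega
  have hsub : ∀ s, ((p ^ (s + 1) - p ^ s : ℕ) : ℤ) = (p : ℤ) ^ (s + 1) - (p : ℤ) ^ s := by
    intro s
    rw [Nat.cast_sub (Nat.pow_le_pow_right hp.out.pos (by omega))]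
    push_cast
    rfl
  rw [sum_padicDigit, h0, h1, sum_gapExponent N hpj, Nat.cast_add, hcount, Nat.cast_sum]
  simp only [count_modEq_self j (pow_pos hp.out.pos _), Nat.cast_mul, hsub, Nat.cast_zero]
  ring

end

/-! ### The enumeration of the points of evaluation -/

theorem prod_range_nth {M : Type*} [CommMonoid M] {P : ℕ → Prop} [DecidablePred P]
    (hP : (Set.ofPred P).Infinite) (f : ℕ → M) (k : ℕ) :
    ∏ l ∈ Finset.range k, f (Nat.nth P l) = ∏ l ∈ Finset.range (Nat.nth P k) with P l, f l := by
  induction k with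
  | zero =>
    have : (Finset.range (Nat.nth P 0)).filter P = ∅ := by
      rw [← Finset.card_eq_zero, ← Nat.count_eq_card_filter_range, Nat.count_nth_zero]
    rw [this, Finset.range_zero, Finset.prod_empty, Finset.prod_empty]
  | succ k ih =>
    rw [Nat.filter_range_nth_eq_insert_of_infinite hP, Finset.prod_insert (by simp),
      Finset.prod_range_succ, ih, mul_comm]

section

variable {p : ℕ} [hp : Fact p.Prime]

theorem infinite_not_dvd (p : ℕ) [hp : Fact p.Prime] :
    (Set.ofPred fun i : ℕ => ¬ p ∣ i).Infinite := by
  refine Set.infinite_of_injective_forall_mem (f := fun k : ℕ => p * k + 1) (fun a b h => ?_) ?_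
  · simpa [hp.out.ne_zero] using h
  · intro k h
    exact hp.out.one_lt.ne' (Nat.dvd_one.1 ((Nat.dvd_add_right (dvd_mul_right p k)).1 h))

/-- The `k`-th natural number that is prime to `p`, counted from `0`. -/
noncomputable def coprimeNth (p k : ℕ) : ℕ := Nat.nth (fun i => ¬ p ∣ i) k

theorem not_dvd_coprimeNth (p k : ℕ) [Fact p.Prime] : ¬ p ∣ coprimeNth p k :=
  Nat.nth_mem_of_infinite (infinite_not_dvd p) k

theorem coprimeNth_injective (p : ℕ) [Fact p.Prime] : Function.Injective (coprimeNth p) :=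
  Nat.nth_injective (infinite_not_dvd p)

theorem totient_prime_pow_eq_count (N : ℕ) :
    (p ^ (N + 1)).totient = (p ^ (N + 1)).count fun i => ¬ p ∣ i := by
  rw [Nat.totient_eq_card_coprime, Nat.count_eq_card_filter_range]
  refine congrArg _ (Finset.filter_congr fun i _ => ?_)
  rw [Nat.coprime_pow_left_iff N.succ_pos, hp.out.coprime_iff_not_dvd]

theorem coprimeNth_lt {N k : ℕ} (hk : k < (p ^ (N + 1)).totient) :
    coprimeNth p k < p ^ (N + 1) :=
  Nat.nth_lt_of_lt_count (totient_prime_pow_eq_count (p := p) N ▸ hk)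

theorem exists_unitsEquiv (p N : ℕ) [hp : Fact p.Prime] :
    ∃ e : Fin (p ^ (N + 1)).totient ≃ (ZMod (p ^ (N + 1)))ˣ,
      ∀ k, (e k : ZMod (p ^ (N + 1))).val = coprimeNth p k := by
  have : NeZero (p ^ (N + 1)) := ⟨pow_ne_zero _ hp.out.ne_zero⟩
  let g : Fin (p ^ (N + 1)).totient → (ZMod (p ^ (N + 1)))ˣ := fun k =>
    ZMod.unitOfCoprime (coprimeNth p k)
      ((hp.out.coprime_iff_not_dvd.2 (not_dvd_coprimeNth p k)).symm.pow_right _)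
  have hg : ∀ k, (g k : ZMod (p ^ (N + 1))).val = coprimeNth p k := fun k => by
    rw [ZMod.coe_unitOfCoprime, ZMod.val_natCast_of_lt (coprimeNth_lt k.2)]
  have hinj : Function.Injective g := fun a b hab =>
    Fin.ext (coprimeNth_injective p (by rw [← hg, ← hg, hab]))
  refine ⟨Equiv.ofBijective g ((Fintype.bijective_iff_injective_and_card g).2 ⟨hinj, ?_⟩), hg⟩
  rw [Fintype.card_fin, ZMod.card_units_eq_totient]

end

/-! ### Elementary divisors of the Dedekind embedding -/

section

variable {R T ι : Type*} [CommRing R] [CommRing T] [Algebra R T]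

theorem span_pow_one_tmul {z : T} {m : ℕ}
    (hz : ⊤ ≤ Submodule.span R (Set.range fun l : Fin m => z ^ (l : ℕ))) :
    ⊤ ≤ Submodule.span T (Set.range fun l : Fin m => ((1 : T) ⊗ₜ[R] z) ^ (l : ℕ)) := by
  have key : ∀ y : T, (1 : T) ⊗ₜ[R] y ∈
      Submodule.span T (Set.range fun l : Fin m => ((1 : T) ⊗ₜ[R] z) ^ (l : ℕ)) := by
    intro y
    refine Submodule.span_induction
      (p := fun y _ => (1 : T) ⊗ₜ[R] y ∈
        Submodule.span T (Set.range fun l : Fin m => ((1 : T) ⊗ₜ[R] z) ^ (l : ℕ)))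
      ?_ ?_ (fun a b _ _ ha hb => ?_) (fun r a _ ha => ?_) (hz (Submodule.mem_top (x := y)))
    · rintro _ ⟨l, rfl⟩
      exact Submodule.subset_span ⟨l, by simp [Algebra.TensorProduct.tmul_pow]⟩
    · rw [TensorProduct.tmul_zero]
      exact zero_mem _
    · rw [TensorProduct.tmul_add]
      exact add_mem ha hb
    · rw [TensorProduct.tmul_smul, ← algebraMap_smul T r]
      exact Submodule.smul_mem _ _ ha
  intro w _
  induction w with
  | zero => exact zero_mem _
  | add a b ha hb => exact add_mem (ha trivial) (hb trivial)
  | tmul x y =>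
    have hxy : x ⊗ₜ[R] y = x • ((1 : T) ⊗ₜ[R] y) := by
      rw [TensorProduct.smul_tmul', smul_eq_mul, mul_one]
    rw [hxy]
    exact Submodule.smul_mem _ _ (key y)

theorem isElementaryDivisorForm_twistedMul [IsDomain T] (σ : ι → T →ₐ[R] T) {z : T} {m : ℕ}
    (hz : ⊤ ≤ Submodule.span R (Set.range fun l : Fin m => z ^ (l : ℕ)))
    (e : Fin m ≃ ι) (x : ℕ → T) (hσ : ∀ k : Fin m, σ (e k) z = x k)
    (hne : ∀ k < m, newton x k (x k) ≠ 0)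
    (hdvd : ∀ k < m, ∀ i < m, newton x k (x k) ∣ newton x k (x i)) :
    IsElementaryDivisorForm (twistedMul σ).toLinearMap
      (fun k : Fin m => newton x k (x k)) :=
  isElementaryDivisorForm_newton (twistedMul σ) (1 ⊗ₜ z) e x (span_pow_one_tmul hz)
    (fun k => by rw [twistedMul_tmul, one_mul, hσ]) hne hdvd

/-- `IsElementaryDivisorForm.emultiplicity_eq` for the map `twistedMul σ`. The instances on the
tensor product are found here for an abstract ring `T`, where the search is cheap. -/
theorem emultiplicity_elementaryDivisor_twistedMul [IsDomain T] {σ : ι → T →ₐ[R] T} {m : ℕ}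
    {d : Fin m → T} (h : IsElementaryDivisorForm (twistedMul σ).toLinearMap d) {t : T}
    (ht : Prime t) (k : Fin m) {e : T}
    (he : IsElementaryDivisor (twistedMul σ).toLinearMap (k + 1) e) :
    emultiplicity t e = emultiplicity t (d k) :=
  h.emultiplicity_eq ht k he

end

section

variable {L : Type*} [Field L] [Algebra ℚ L] {p N : ℕ} [hp : Fact p.Prime] {ζ : L}

/-- Powers of `ζ` of exponent below the degree of the cyclotomic polynomial generate `ℤ_(p)[ζ]`
over `ℤ_(p)`. -/
theorem span_pow_zetaElt {k : ℕ} (hk : 0 < k) (hζ : IsPrimitiveRoot ζ k) :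
    ⊤ ≤ Submodule.span (ZLoc p) (Set.range fun l : Fin k.totient =>
      zetaElt p ζ ^ (l : ℕ)) := by
  have hadj : Algebra.adjoin (ZLoc p) {zetaElt p ζ} = ⊤ := by
    have h := Algebra.adjoin_adjoin_coe_preimage (R := ZLoc p) (s := {ζ})
    have hset : (Subtype.val ⁻¹' {ζ} : Set (Algebra.adjoin (ZLoc p) {ζ})) = {zetaElt p ζ} := by
      ext x
      exact (Subtype.ext_iff (a1 := x) (a2 := zetaElt p ζ)).symm
    rw [hset] at h
    exact h
  have hroot : Polynomial.aeval (zetaElt p ζ) (Polynomial.cyclotomic k (ZLoc p)) = 0 := by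
    rw [Polynomial.aeval_def, Polynomial.eval₂_eq_eval_map, Polynomial.map_cyclotomic]
    exact (isPrimitiveRoot_zetaElt hζ).isRoot_cyclotomic hk
  have hspan := Submodule.span_range_natDegree_eq_adjoin
    (Polynomial.cyclotomic.monic k (ZLoc p)) hroot
  rw [hadj, Polynomial.natDegree_cyclotomic, Algebra.top_toSubmodule] at hspan
  refine hspan.ge.trans (Submodule.span_mono fun y hy => ?_)
  simp only [Finset.coe_image] at hy
  obtain ⟨l, hl, rfl⟩ := hy
  exact ⟨⟨l, Finset.mem_range.1 (Finset.mem_coe.1 hl)⟩, rfl⟩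

/-- The `k`-th point of evaluation. -/
noncomputable def cycNode (p : ℕ) [Fact p.Prime] (ζ : L) (k : ℕ) : CycRing p ζ :=
  zetaElt p ζ ^ coprimeNth p k

theorem newton_cycNode (k i : ℕ) :
    newton (cycNode p ζ) k (cycNode p ζ i) =
      ∏ l ∈ Finset.range (coprimeNth p k) with ¬ p ∣ l,
        (zetaElt p ζ ^ coprimeNth p i - zetaElt p ζ ^ l) := by
  rw [newton_self]
  exact prod_range_nth (infinite_not_dvd p)
    (fun l => zetaElt p ζ ^ coprimeNth p i - zetaElt p ζ ^ l) k

theorem associated_newton_cycNode (hζ : IsPrimitiveRoot ζ (p ^ (N + 1))) {k i : ℕ}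
    (hki : k ≤ i) (hi : i < (p ^ (N + 1)).totient) :
    Associated (newton (cycNode p ζ) k (cycNode p ζ i))
      (tElt p ζ ^ ∑ l ∈ Finset.range (coprimeNth p k) with ¬ p ∣ l,
        gapExponent p N (coprimeNth p i) l) := by
  rw [newton_cycNode, ← Finset.prod_pow_eq_pow_sum]
  refine Associated.prod _ _ _ fun l hl => ?_
  have hlk := Finset.mem_range.1 (Finset.mem_filter.1 hl).1
  have hlt := hlk.trans_le (Nat.nth_monotone (infinite_not_dvd p) hki)
  exact associated_pow_sub_pow (isPrimitiveRoot_zetaElt hζ) (coprimeNth_lt hi)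
    (hlt.trans (coprimeNth_lt hi)) hlt.ne'

theorem isElementaryDivisorForm_dedekind [IsCyclotomicExtension {p ^ (N + 1)} ℚ L]
    (hζ : IsPrimitiveRoot ζ (p ^ (N + 1))) :
    IsElementaryDivisorForm (dedekind hζ).toLinearMap
      (fun k : Fin (p ^ (N + 1)).totient => newton (cycNode p ζ) k (cycNode p ζ k)) := by
  obtain ⟨e, he⟩ := exists_unitsEquiv p N
  have hass := fun k hk => associated_newton_cycNode hζ (le_refl k) hk
  refine isElementaryDivisorForm_twistedMul (ringAut hζ)
    (span_pow_zetaElt (pow_pos hp.out.pos _) hζ) e (cycNode p ζ) (fun k => ?_) (fun k hk => ?_)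
    (fun k hk i hi => ?_)
  · rw [cycNode, ← he k]
    exact Subtype.ext (fieldAut_apply hζ (e k))
  · exact (hass k hk).ne_zero_iff.2 (pow_ne_zero _ (prime_tElt hζ).ne_zero)
  · rcases lt_or_ge i k with hik | hki
    · rw [newton_eq_zero _ hik]
      exact dvd_zero _
    · rw [(hass k hk).dvd_iff_dvd_left, (associated_newton_cycNode hζ hki hi).dvd_iff_dvd_right]
      exact pow_dvd_pow _
        (sum_gapExponent_le N (not_dvd_coprimeNth p k) (not_dvd_coprimeNth p i))

end

theorem numNonMultiples_eq {p j : ℕ} (hpj : ¬ p ∣ j) :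
    numNonMultiples p j = j.count (fun i => ¬ p ∣ i) + 1 := by
  have h : Finset.Icc 0 j = Finset.range (j + 1) := by ext; simp
  rw [numNonMultiples, h, ← Nat.count_eq_card_filter_range, Nat.count_succ, if_pos hpj]

end CycDedekind

theorem mainTheorem1 (p n : ℕ) [Fact p.Prime] (hn : 1 ≤ n)
    {L : Type*} [Field L] [Algebra ℚ L] [IsCyclotomicExtension {p ^ n} ℚ L]
    (ζ : L) (hζ : IsPrimitiveRoot ζ (p ^ n))
    (j : ℕ) (hj : j ≤ p ^ n - 1) (hpj : ¬ p ∣ j) :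
    (∃ e, CycDedekind.IsElementaryDivisor (CycDedekind.dedekind hζ).toLinearMap
        (CycDedekind.numNonMultiples p j) e) ∧
      ∀ e, CycDedekind.IsElementaryDivisor (CycDedekind.dedekind hζ).toLinearMap
          (CycDedekind.numNonMultiples p j) e →
        ∃ v : ℕ, emultiplicity (CycDedekind.tElt p ζ) e = v ∧
          (v : ℤ) = -1 + ∑ s ∈ Finset.range n,
            ((CycDedekind.padicDigit p j s : ℤ) * (s + 1) -
              (CycDedekind.padicDigit p j (s + 1) : ℤ) * (s + 2)) * (p : ℤ) ^ s := by
  obtain ⟨N, rfl⟩ : ∃ N, n = N + 1 := ⟨n - 1, by omega⟩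
  have hpos : 0 < p ^ (N + 1) := pow_pos (Fact.out : p.Prime).pos _
  have hjlt : j < p ^ (N + 1) := by omega
  have hk : j.count (fun i => ¬ p ∣ i) < (p ^ (N + 1)).totient := by
    rw [CycDedekind.totient_prime_pow_eq_count]
    exact Nat.count_strict_mono hpj hjlt
  have hnth : CycDedekind.coprimeNth p (j.count fun i => ¬ p ∣ i) = j := Nat.nth_count hpj
  have hform := CycDedekind.isElementaryDivisorForm_dedekind hζ
  have ht := CycDedekind.prime_tElt hζ
  rw [CycDedekind.numNonMultiples_eq hpj]
  refine ⟨⟨_, _, _, hform, ⟨_, hk⟩, rfl, rfl⟩, fun e he => ⟨_, ?_,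
    CycDedekind.sum_gapExponent_self hjlt hpj⟩⟩
  rw [CycDedekind.emultiplicity_elementaryDivisor_twistedMul hform ht ⟨_, hk⟩ he,
    emultiplicity_eq_of_associated_right (CycDedekind.associated_newton_cycNode hζ le_rfl hk),
    hnth, emultiplicity_pow_self_of_prime ht]
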